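/- **Conventions.** For a real number $c$ and a distribution $g$ on an open interval, put $\partial_c g=((x-c)g)'$. Let $f\in\mathcal D'(a,b)$, $x_0\in(a,b)$ and $\gamma\in\mathbb C$. - The lateral limit $f(x_0+0)=\gamma$ (Łojasiewicz) exists if $\lim_{\varepsilon\to0^+}\langle f(x_0+\varepsilon x),\phi(x)\rangle=\gamma\int\phi(x)\,dx$ for every $\phi\in\mathcal D(\mathbb R)$ with support contained in $(0,\infty)$. Here $\langle f(x_0+\varepsilon x),\phi(x)\rangle=\langle f(t),\varepsilon^{-1}\phi((t-x_0)/\varepsilon)\rangle$, which is defined for all small $\varepsilon>0$. - The point value $f(x_0)=\gamma$ (Łojasiewicz) exists and is of order $n$ if there is $f_n\in\mathcal D'(a,b)$ with $f=\partial_{x_0}^n f_n$ such that $f_n$ is a continuous function near $x_0$ and $f_n(x_0)=\gamma$. The point value exists if this holds for some $n\ge 0$. **Theorem.** Let $a<b$ and $R>0$ be real numbers, and let $F$ be analytic and bounded in the rectangle $\{x+iy: a<x<b,\ 0<y<R\}$. Then $f=\lim_{y\to0^+}F(\,\cdot+iy)$ exists in $\mathcal D'(a,b)$, and $f\in L^\infty(a,b)$.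 Let $x_0\in(a,b)$ and $\gamma\in\mathbb C$ be such that the lateral limit $f(x_0+0)=\gamma$ (Łojasiewicz) exists. Then the distributional point value $f(x_0)=\gamma$ (Łojasiewicz) also exists; equivalently, $$\lim_{\varepsilon\to0^+}\langle f(x_0+\varepsilon x),\phi(x)\rangle=\gamma\int_{-\infty}^{\infty}\phi(x)\,dx\qquad\text{for every }\phi\in\mathcal D(\mathbb R).$$ In fact, the point value is of the first order, and $$\lim_{x\to x_0}\frac1{x-x_0}\int_{x_0}^x f(t)\,dt=\gamma .$$ -/

import Mathlib

open Set Filter Topology MeasureTheory TopologicalSpace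
open scoped Distributions ContDiff

noncomputable section

/-- The open interval `(a, b)`, as an open subset of `ℝ`. -/
def openInterval (a b : ℝ) : Opens ℝ := ⟨Ioo a b, isOpen_Ioo⟩

/-- The right half-line `(0, ∞)`, as an open subset of `ℝ`. -/
def rightHalfLine : Opens ℝ := ⟨Ioi 0, isOpen_Ioi⟩

/-- The distribution `T` on `Ω` coincides on the open set `U` with the locally integrable
function `h`. -/
def IsGivenByOn {Ω : Opens ℝ} (T : 𝓓'(Ω, ℂ)) (h : ℝ → ℂ) (U : Set ℝ) : Prop :=
  LocallyIntegrableOn h U ∧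
    ∀ φ : 𝓓(Ω, ℝ), tsupport φ ⊆ U → T φ = ∫ x, φ x • h x

/-- `T = lim_{y → 0⁺} F(· + i y)` in the space of distributions on `Ω`. -/
def IsBoundaryValue {Ω : Opens ℝ} (F : ℂ → ℂ) (T : 𝓓'(Ω, ℂ)) : Prop :=
  ∀ φ : 𝓓(Ω, ℝ), Tendsto (fun y : ℝ => ∫ x : ℝ, φ x • F (x + y * Complex.I))
    (𝓝[>] 0) (𝓝 (T φ))

open Classical in
/-- The test function `t ↦ ε⁻¹ φ((t - x₀) / ε)` on `Ω`, so that
`⟨f(x₀ + ε x), φ(x)⟩ = ⟨f(t), ε⁻¹ φ((t - x₀) / ε)⟩`. For `x₀ ∈ Ω` and all sufficiently small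
`ε > 0` its support lies in `Ω`; when it does not, we put `0`. -/
def dilateTest {V : Opens ℝ} (Ω : Opens ℝ) (x₀ ε : ℝ) (φ : 𝓓(V, ℝ)) : 𝓓(Ω, ℝ) :=
  if h : ε ≠ 0 ∧ tsupport (fun t : ℝ => ε⁻¹ * φ (ε⁻¹ * (t - x₀))) ⊆ Ω then
    { toFun := fun t => ε⁻¹ * φ (ε⁻¹ * (t - x₀))
      contDiff' := by
        have h1 := φ.contDiff
        exact contDiff_const.mul (h1.comp (contDiff_const.mul (contDiff_id.sub contDiff_const)))
      hasCompactSupport' := by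
        have e : ε⁻¹ ≠ 0 := inv_ne_zero h.1
        have h2 : HasCompactSupport (fun t : ℝ => φ (ε⁻¹ * (t - x₀))) :=
          φ.hasCompactSupport.comp_homeomorph
            ((Homeomorph.subRight x₀).trans (Homeomorph.mulLeft₀ ε⁻¹ e))
        exact h2.mul_left
      tsupport_subset' := h.2 }
  else 0

/-- `lim_{ε → 0⁺} ⟨f(x₀ + ε x), φ(x)⟩ = γ ∫ φ` for every test function `φ` supported in `V`. -/
def HasDilationLimit {Ω : Opens ℝ} (V : Opens ℝ) (T : 𝓓'(Ω, ℂ)) (x₀ : ℝ) (γ : ℂ) : Prop :=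
  ∀ φ : 𝓓(V, ℝ), Tendsto (fun ε : ℝ => T (dilateTest Ω x₀ ε φ)) (𝓝[>] 0)
    (𝓝 (γ * ((∫ x, φ x : ℝ) : ℂ)))

/-- The distributional lateral limit from the right `f(x₀ + 0) = γ` (Łojasiewicz). -/
def HasRightLimit {Ω : Opens ℝ} (T : 𝓓'(Ω, ℂ)) (x₀ : ℝ) (γ : ℂ) : Prop :=
  HasDilationLimit rightHalfLine T x₀ γ

/-- The test function `x ↦ -(x - c) φ'(x)`, the transpose of `g ↦ ((x - c) g)'` applied to `φ`. -/
def eulerTest {Ω : Opens ℝ} (c : ℝ) (φ : 𝓓(Ω, ℝ)) : 𝓓(Ω, ℝ) where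
  toFun := fun x => -(x - c) * deriv φ x
  contDiff' := by
    have h1 : ContDiff ℝ ∞ (φ : ℝ → ℝ) := φ.contDiff
    exact (contDiff_id.sub contDiff_const).neg.mul (contDiff_infty_iff_deriv.1 h1).2
  hasCompactSupport' := φ.hasCompactSupport.deriv.mul_left
  tsupport_subset' := ((tsupport_mul_subset_right).trans
    (closure_minimal (support_deriv_subset) (isClosed_tsupport _))).trans φ.tsupport_subset

/-- `T = ∂_c S := ((x - c) S)'` in the sense of distributions on `Ω`. -/
def IsPartial {Ω : Opens ℝ} (c : ℝ) (S T : 𝓓'(Ω, ℂ)) : Prop :=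
  ∀ φ : 𝓓(Ω, ℝ), T φ = S (eulerTest c φ)

/-- The point value `f(x₀) = γ` (Łojasiewicz) exists and is of order `n`: there are distributions
`f = f₀, f₁, …, fₙ` with `f_k = ∂_{x₀} f_{k+1}` such that `fₙ` is a continuous function near `x₀`
and `fₙ(x₀) = γ`. -/
def HasPointValueOfOrder {Ω : Opens ℝ} (n : ℕ) (T : 𝓓'(Ω, ℂ)) (x₀ : ℝ) (γ : ℂ) : Prop :=
  ∃ S : ℕ → 𝓓'(Ω, ℂ), S 0 = T ∧ (∀ k < n, IsPartial x₀ (S (k + 1)) (S k)) ∧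
    ∃ (U : Set ℝ) (h : ℝ → ℂ), IsOpen U ∧ x₀ ∈ U ∧ U ⊆ Ω ∧ ContinuousOn h U ∧ h x₀ = γ ∧
      IsGivenByOn (S n) h U

/-- The point value `f(x₀) = γ` (Łojasiewicz) exists. -/
def HasPointValue {Ω : Opens ℝ} (T : 𝓓'(Ω, ℂ)) (x₀ : ℝ) (γ : ℂ) : Prop :=
  ∃ n : ℕ, HasPointValueOfOrder n T x₀ γ

end

open scoped NNReal

/-! On the convex rectangle `F` has a primitive, Lipschitz because `F` is bounded; extend it to a
Lipschitz `G` on the plane. With `g = G` on the real axis, the boundary value of `F` is `g'`, an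
`L^∞` function, and everything reduces to showing that `g` is differentiable at `x₀` with derivative
`γ`.

The lateral limit gives the right derivative (`HasRightLimit.tendsto_right_slope`): since `g'` is
bounded, the indicator of `(0, 1]` may replace a test function close to it in `L¹`.

To reach the left side, blow up: the functions `(G (x₀ + ε z) - G x₀) / ε` share one Lipschitz
constant, so along any ultrafilter they converge to a Lipschitz `H`, holomorphic in the upper
half-plane, with `H s = γ s` for `s > 0`. Then `H z / z - γ` is bounded and vanishes on the positive
ray, so the three lines theorem in the coordinate `log z` makes it vanish identically, and `H (-1) =
-γ` whatever the ultrafilter (`LipschitzWith.tendsto_left_of_tendsto_right`). -/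

/-! ### Calculus of complex-valued Lipschitz functions on the line. -/

theorem LipschitzWith.ae_deriv_re_im {L : ℝ → ℂ} {K : ℝ≥0} (hL : LipschitzWith K L) :
    ∀ᵐ x, deriv (fun t => (L t).re) x = (deriv L x).re ∧
      deriv (fun t => (L t).im) x = (deriv L x).im := by
  filter_upwards [hL.ae_differentiableAt_real] with x hx
  have h := hx.hasDerivAt
  exact ⟨(Complex.reCLM.hasFDerivAt.comp_hasDerivAt x h).deriv,
    (Complex.imCLM.hasFDerivAt.comp_hasDerivAt x h).deriv⟩

theorem LipschitzWith.complex_re {L : ℝ → ℂ} {K : ℝ≥0} (hL : LipschitzWith K L) :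
    LipschitzWith K (fun t => (L t).re) :=
  LipschitzWith.of_dist_le_mul fun x y =>
    (by simpa [Real.dist_eq, dist_eq_norm] using Complex.abs_re_le_norm (L x - L y) :
      dist (L x).re (L y).re ≤ dist (L x) (L y)).trans (hL.dist_le_mul x y)

theorem LipschitzWith.complex_im {L : ℝ → ℂ} {K : ℝ≥0} (hL : LipschitzWith K L) :
    LipschitzWith K (fun t => (L t).im) :=
  LipschitzWith.of_dist_le_mul fun x y =>
    (by simpa [Real.dist_eq, dist_eq_norm] using Complex.abs_im_le_norm (L x - L y) :
      dist (L x).im (L y).im ≤ dist (L x) (L y)).trans (hL.dist_le_mul x y)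

theorem LipschitzWith.locallyIntegrable_deriv {L : ℝ → ℂ} {K : ℝ≥0} (hL : LipschitzWith K L) :
    LocallyIntegrable (deriv L) := by
  refine (locallyIntegrable_const (K : ℝ)).mono (measurable_deriv L).aestronglyMeasurable ?_
  exact Eventually.of_forall fun x => by
    simpa using norm_deriv_le_of_lipschitz hL (x₀ := x)

theorem LipschitzWith.intervalIntegral_deriv_eq_sub {L : ℝ → ℂ} {K : ℝ≥0}
    (hL : LipschitzWith K L) (u v : ℝ) : ∫ x in u..v, deriv L x = L v - L u := by
  have hi : IntervalIntegrable (deriv L) volume u v :=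
    (hL.locallyIntegrable_deriv.integrableOn_isCompact isCompact_uIcc).intervalIntegrable
  apply Complex.ext
  · rw [← Complex.reCLM_apply, ← Complex.reCLM.intervalIntegral_comp_comm hi, Complex.sub_re,
      ← hL.complex_re.lipschitzOnWith.absolutelyContinuousOnInterval.integral_deriv_eq_sub]
    refine intervalIntegral.integral_congr_ae ?_
    filter_upwards [hL.ae_deriv_re_im] with x hx _
    exact hx.1.symm
  · rw [← Complex.imCLM_apply, ← Complex.imCLM.intervalIntegral_comp_comm hi, Complex.sub_im,
      ← hL.complex_im.lipschitzOnWith.absolutelyContinuousOnInterval.integral_deriv_eq_sub]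
    refine intervalIntegral.integral_congr_ae ?_
    filter_upwards [hL.ae_deriv_re_im] with x hx _
    exact hx.2.symm

/-- Integration by parts of a Lipschitz function against a test function. -/
theorem LipschitzWith.integral_smul_deriv_eq {L : ℝ → ℂ} {K : ℝ≥0} (hL : LipschitzWith K L)
    {φ : ℝ → ℝ} (hφ : ContDiff ℝ ∞ φ) (hc : HasCompactSupport φ) :
    ∫ x, φ x • deriv L x = -∫ x, deriv φ x • L x := by
  obtain ⟨D, hD⟩ := ContDiff.lipschitzWith_of_hasCompactSupport hc hφ (by simp)
  have hφ' : Continuous (deriv φ) := hφ.continuous_deriv (by simp)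
  have i1 := hL.locallyIntegrable_deriv.integrable_smul_left_of_hasCompactSupport hφ.continuous hc
  have i2 := hL.continuous.locallyIntegrable.integrable_smul_left_of_hasCompactSupport (μ := volume)
    hφ' hc.deriv
  -- The real-valued case is the line-derivative integration by parts in the direction `1`.
  have key : ∀ {u : ℝ → ℝ}, LipschitzWith K u → ∫ x, φ x * deriv u x = -∫ x, deriv φ x * u x := by
    intro u hu
    have h := LipschitzWith.integral_lineDeriv_mul_eq (μ := volume) hu hD hc (1 : ℝ)
    have e : ∀ x, lineDeriv ℝ φ x (-1) = -deriv φ x := fun x => by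
      rw [lineDeriv_neg, lineDeriv]; congr 1
      simpa using deriv_comp_const_add φ x 0
    have e' : ∀ x, lineDeriv ℝ u x 1 = deriv u x := fun x => by
      rw [lineDeriv]; simpa using deriv_comp_const_add u x 0
    simp only [e, e', neg_mul, integral_neg] at h
    simpa only [mul_comm (φ _)] using h
  apply Complex.ext
  · rw [Complex.neg_re, ← Complex.reCLM_apply, ← Complex.reCLM_apply,
      ← Complex.reCLM.integral_comp_comm i1, ← Complex.reCLM.integral_comp_comm i2]
    simp only [Complex.reCLM_apply, Complex.smul_re, smul_eq_mul]
    rw [← key hL.complex_re]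
    refine integral_congr_ae ?_
    filter_upwards [hL.ae_deriv_re_im] with x hx
    rw [hx.1]
  · rw [Complex.neg_im, ← Complex.imCLM_apply, ← Complex.imCLM_apply,
      ← Complex.imCLM.integral_comp_comm i1, ← Complex.imCLM.integral_comp_comm i2]
    simp only [Complex.imCLM_apply, Complex.smul_im, smul_eq_mul]
    rw [← key hL.complex_im]
    refine integral_congr_ae ?_
    filter_upwards [hL.ae_deriv_re_im] with x hx
    rw [hx.2]

/-! ### Lipschitz primitives on the rectangle. -/

/-- The open rectangle `(a, b) × (0, R)` in the complex plane. -/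
def openRectangle (a b R : ℝ) : Set ℂ := {z : ℂ | z.re ∈ Ioo a b ∧ z.im ∈ Ioo 0 R}

theorem isOpen_openRectangle (a b R : ℝ) : IsOpen (openRectangle a b R) :=
  (isOpen_Ioo.preimage Complex.continuous_re).inter (isOpen_Ioo.preimage Complex.continuous_im)

theorem convex_openRectangle (a b R : ℝ) : Convex ℝ (openRectangle a b R) :=
  ((convex_Ioo a b).linear_preimage Complex.reLm).inter
    ((convex_Ioo 0 R).linear_preimage Complex.imLm)

/-- A bounded holomorphic function on a rectangle has a primitive which extends to a Lipschitz
function on the plane. -/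
theorem exists_lipschitzWith_primitive {a b R : ℝ} {F : ℂ → ℂ}
    (hF : DifferentiableOn ℂ F (openRectangle a b R))
    (hbdd : ∃ M : ℝ, ∀ z ∈ openRectangle a b R, ‖F z‖ ≤ M) :
    ∃ (G : ℂ → ℂ) (K : ℝ≥0), LipschitzWith K G ∧
      ∀ z ∈ openRectangle a b R, HasDerivAt G (F z) z := by
  obtain ⟨M, hM⟩ := hbdd
  obtain ⟨G₀, hG₀⟩ := (convex_openRectangle a b R).exists_forall_hasDerivWithinAt hF
  have hlip : LipschitzOnWith M.toNNReal G₀ (openRectangle a b R) :=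
    (convex_openRectangle a b R).lipschitzOnWith_of_nnnorm_hasDerivWithin_le hG₀ fun z hz =>
      NNReal.le_toNNReal_of_coe_le (hM z hz)
  -- The extension may enlarge the Lipschitz constant; derivatives survive because the rectangle is
  -- open.
  obtain ⟨G, hG, hEq⟩ := hlip.extend_finite_dimension
  refine ⟨G, _, hG, fun z hz => ?_⟩
  have hn := (isOpen_openRectangle a b R).mem_nhds hz
  exact ((hG₀ z hz).hasDerivAt hn).congr_of_eventuallyEq (hEq.symm.eventuallyEq_of_mem hn)

/-! ### Blow-ups and passage from the right to the left. -/

/-- A Lipschitz function, holomorphic in the upper half-plane and linear on the positive half-line,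
is given by the same linear function at `-1`. -/
theorem LipschitzWith.apply_neg_one_of_eq_on_pos {H : ℂ → ℂ} {K : ℝ≥0} (hH : LipschitzWith K H)
    (h0 : H 0 = 0) (hd : DifferentiableOn ℂ H {z | 0 < z.im}) {γ : ℂ}
    (hpos : ∀ s : ℝ, 0 < s → H s = γ * s) : H (-1) = -γ := by
  -- This maps the strip `0 < re w < 1` into the upper half-plane, the edge `re w = 0` into the
  -- positive ray, and `1` to `-1`.
  set e : ℂ → ℂ := fun w => Complex.exp (Real.pi * Complex.I * w) with he
  have e_ne : ∀ w, e w ≠ 0 := fun w => Complex.exp_ne_zero _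
  have e_diff : Differentiable ℂ e := by fun_prop
  set k : ℂ → ℂ := fun w => H (e w) / e w - γ with hk
  have k_cont : Continuous k :=
    ((hH.continuous.comp e_diff.continuous).div e_diff.continuous e_ne).sub continuous_const
  have k_bound : ∀ w, ‖k w‖ ≤ K + ‖γ‖ := fun w => by
    refine (_root_.norm_sub_le _ _).trans (add_le_add ?_ le_rfl)
    rw [norm_div, div_le_iff₀ (norm_pos_iff.2 (e_ne w))]
    simpa [h0] using hH.dist_le_mul (e w) 0
  have k_diff : DifferentiableOn ℂ k (Complex.HadamardThreeLines.verticalStrip 0 1) := by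
    have hm : MapsTo e (Complex.HadamardThreeLines.verticalStrip 0 1) {z | 0 < z.im} := by
      intro w hw
      have hw' : 0 < w.re ∧ w.re < 1 := hw
      simp only [mem_ofPred_eq, he, Complex.exp_im]
      refine mul_pos (Real.exp_pos _) (Real.sin_pos_of_pos_of_lt_pi ?_ ?_)
      · simpa using mul_pos Real.pi_pos hw'.1
      · simpa using mul_lt_mul_of_pos_left hw'.2 Real.pi_pos
    exact ((hd.comp e_diff.differentiableOn hm).div e_diff.differentiableOn
      fun w _ => e_ne w).sub_const γ
  have k_zero : ∀ w ∈ Complex.re ⁻¹' {0}, ‖k w‖ ≤ 0 := by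
    intro w hw
    have hw' : w.re = 0 := hw
    have : e w = ((Real.exp (-(Real.pi * w.im)) : ℝ) : ℂ) := by
      have harg : Real.pi * Complex.I * w = ((-(Real.pi * w.im) : ℝ) : ℂ) := by
        apply Complex.ext <;> simp [hw']
      simp only [he, harg, Complex.ofReal_exp]
    simp only [hk, this, norm_le_zero_iff]
    rw [hpos _ (Real.exp_pos _), mul_div_cancel_right₀ _ (by simp), sub_self]
  have k_real : ∀ t ∈ Ico (0 : ℝ) 1, k t = 0 := by
    intro t ht
    -- The bound is `0 ^ (1 - t) * (K + ‖γ‖) ^ t`, which is zero only for `t < 1`; the point `1`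
    -- follows by continuity.
    have := Complex.HadamardThreeLines.norm_le_interp_of_mem_verticalClosedStrip₀₁' k (z := t)
      (a := 0) (b := K + ‖γ‖) ⟨by simpa using ht.1, by simpa using ht.2.le⟩
      ⟨k_diff, k_cont.continuousOn⟩ ⟨K + ‖γ‖, by rintro _ ⟨w, _, rfl⟩; exact k_bound w⟩
      k_zero (fun w _ => k_bound w)
    rw [Complex.ofReal_re, Real.zero_rpow (sub_pos.2 ht.2).ne', zero_mul] at this
    exact norm_le_zero_iff.1 this
  have k_one : k 1 = 0 := by
    have h1 : Tendsto (fun t : ℝ => k t) (𝓝[<] 1) (𝓝 (k 1)) := by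
      have := (k_cont.comp Complex.continuous_ofReal).tendsto (1 : ℝ)
      simpa [Function.comp_def] using this.mono_left nhdsWithin_le_nhds
    refine tendsto_nhds_unique h1 (tendsto_const_nhds.congr' ?_)
    filter_upwards [Ico_mem_nhdsLT (zero_lt_one' ℝ)] with t ht
    exact (k_real t ht).symm
  have e_one : e 1 = -1 := by simp [he, Complex.exp_pi_mul_I]
  simp only [hk, e_one, div_neg, div_one] at k_one
  linear_combination -k_one

/-- The difference quotients of a Lipschitz function along a direction `z`, as `ε` varies,
converge along every ultrafilter. -/
theorem LipschitzWith.exists_tendsto_blowup {G : ℂ → ℂ} {K : ℝ≥0} (hG : LipschitzWith K G)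
    (x₀ z : ℂ) {U : Ultrafilter ℝ} (hU : (U : Filter ℝ) ≤ 𝓝[>] 0) :
    ∃ w, Tendsto (fun ε : ℝ => (G (x₀ + ε * z) - G x₀) / ε) U (𝓝 w) := by
  have hmem : ∀ᶠ ε : ℝ in (U : Filter ℝ),
      (G (x₀ + ε * z) - G x₀) / ε ∈ Metric.closedBall (0 : ℂ) (K * ‖z‖) := by
    filter_upwards [hU self_mem_nhdsWithin] with ε hε
    have hε : 0 < ε := hε
    rw [mem_closedBall_zero_iff, norm_div, Complex.norm_real, Real.norm_of_nonneg hε.le,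
      div_le_iff₀ hε]
    have := hG.dist_le_mul (x₀ + ε * z) x₀
    rw [dist_eq_norm, dist_eq_norm, add_sub_cancel_left, norm_mul, Complex.norm_real,
      Real.norm_of_nonneg hε.le] at this
    linarith
  obtain ⟨w, -, hw⟩ := (isCompact_closedBall (0 : ℂ) (K * ‖z‖)).ultrafilter_le_nhds'
    (U.map fun ε : ℝ => (G (x₀ + ε * z) - G x₀) / ε) hmem
  exact ⟨w, hw⟩

theorem LipschitzWith.blowup {G : ℂ → ℂ} {K : ℝ≥0} (hG : LipschitzWith K G) (x₀ : ℂ) {ε : ℝ}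
    (hε : 0 < ε) : LipschitzWith K fun z => (G (x₀ + ε * z) - G x₀) / ε := by
  refine LipschitzWith.of_dist_le_mul fun z w => ?_
  have := hG.dist_le_mul (x₀ + ε * z) (x₀ + ε * w)
  rw [dist_eq_norm, dist_eq_norm, add_sub_add_left_eq_sub, ← mul_sub, norm_mul, Complex.norm_real,
    Real.norm_of_nonneg hε.le] at this
  rw [dist_eq_norm, dist_eq_norm, ← sub_div, sub_sub_sub_cancel_right, norm_div, Complex.norm_real,
    Real.norm_of_nonneg hε.le, div_le_iff₀ hε]
  linarith

/-- A common Lipschitz constant upgrades pointwise to locally uniform convergence, which is what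
preserves holomorphy of the blow-up limit. -/
theorem tendstoLocallyUniformlyOn_of_lipschitzWith {ι : Type*} {l : Filter ι} {u : ι → ℂ → ℂ}
    {H : ℂ → ℂ} {K : ℝ≥0} (hu : ∀ᶠ i in l, LipschitzWith K (u i)) (hH : LipschitzWith K H)
    (h : ∀ z, Tendsto (fun i => u i z) l (𝓝 (H z))) (s : Set ℂ) :
    TendstoLocallyUniformlyOn u H l s := by
  rw [Metric.tendstoLocallyUniformlyOn_iff]
  intro η hη z _
  have hK : (0 : ℝ) < K + 1 := by positivity
  refine ⟨Metric.ball z (η / (3 * (K + 1))),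
    mem_nhdsWithin_of_mem_nhds (Metric.ball_mem_nhds z (by positivity)), ?_⟩
  filter_upwards [hu, Metric.tendsto_nhds.1 (h z) (η / 3) (by positivity)] with i hi hz y hy
  have hd : K * dist y z ≤ η / 3 := by
    have h1 : dist y z ≤ η / (3 * (K + 1)) := (Metric.mem_ball.1 hy).le
    calc K * dist y z ≤ (K + 1) * (η / (3 * (K + 1))) := by gcongr; linarith
      _ = η / 3 := by field_simp
  have h1 := hi.dist_le_mul y z
  have h2 := hH.dist_le_mul y z
  have t1 := dist_triangle (H y) (H z) (u i y)
  have t2 := dist_triangle (H z) (u i z) (u i y)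
  rw [dist_comm (H z) (u i z), dist_comm (u i z) (u i y)] at t2
  linarith

/-- For a Lipschitz function holomorphic in a rectangle above the real axis, the existence of the
right derivative along the axis implies that of the left derivative, with the same value. -/
theorem LipschitzWith.tendsto_left_of_tendsto_right {a b R x₀ : ℝ} {G : ℂ → ℂ} {K : ℝ≥0}
    (hG : LipschitzWith K G) (hR : 0 < R) (hx₀ : x₀ ∈ Ioo a b)
    (hd : DifferentiableOn ℂ G (openRectangle a b R)) {γ : ℂ}
    (hr : Tendsto (fun ε : ℝ => (G (x₀ + ε) - G x₀) / ε) (𝓝[>] 0) (𝓝 γ)) :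
    Tendsto (fun ε : ℝ => (G (x₀ + ε * (-1)) - G x₀) / ε) (𝓝[>] 0) (𝓝 (-γ)) := by
  rw [tendsto_iff_ultrafilter]
  intro U hU
  -- One ultrafilter serves all directions `z` at once, so no diagonal subsequence is needed.
  choose H hH using fun z => hG.exists_tendsto_blowup x₀ z hU
  have hlip : ∀ᶠ ε : ℝ in (U : Filter ℝ),
      LipschitzWith K fun z : ℂ => (G (x₀ + ε * z) - G x₀) / ε := by
    filter_upwards [hU self_mem_nhdsWithin] with ε hε using hG.blowup x₀ hε
  have hHlip : LipschitzWith K H := by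
    refine LipschitzWith.of_dist_le_mul fun z w => le_of_tendsto ((hH z).dist (hH w)) ?_
    filter_upwards [hlip] with ε hε using hε.dist_le_mul z w
  have h0 : H 0 = 0 := tendsto_nhds_unique (hH 0) (by simp)
  have hpos : ∀ s : ℝ, 0 < s → H s = γ * s := by
    intro s hs
    refine tendsto_nhds_unique (hH s) (Tendsto.mono_left ?_ hU)
    have hm : Tendsto (fun ε : ℝ => ε * s) (𝓝[>] 0) (𝓝[>] 0) := by
      refine tendsto_nhdsWithin_iff.2 ⟨?_, ?_⟩
      · exact ((continuous_mul_const s).tendsto' 0 0 (zero_mul s)).mono_left nhdsWithin_le_nhds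
      · filter_upwards [self_mem_nhdsWithin] with ε hε using mul_pos hε hs
    refine ((hr.comp hm).mul_const (s : ℂ)).congr' ?_
    filter_upwards [self_mem_nhdsWithin] with ε hε
    have h1 : (ε : ℂ) ≠ 0 := Complex.ofReal_ne_zero.2 (ne_of_gt hε)
    have h2 : (s : ℂ) ≠ 0 := Complex.ofReal_ne_zero.2 hs.ne'
    simp only [Function.comp_apply, Complex.ofReal_mul]
    field_simp
  have hHd : DifferentiableOn ℂ H {z | 0 < z.im} := by
    intro z hz
    -- Bounded, so that a single threshold on `ε` sends all of `x₀ + ε V` into the rectangle.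
    set V : Set ℂ := Metric.ball 0 (‖z‖ + 1) ∩ {z | 0 < z.im}
    have hV : IsOpen V :=
      Metric.isOpen_ball.inter (isOpen_lt continuous_const Complex.continuous_im)
    have hzV : z ∈ V := ⟨by simp, hz⟩
    refine ((TendstoLocallyUniformlyOn.differentiableOn
      (tendstoLocallyUniformlyOn_of_lipschitzWith hlip hHlip hH V) ?_ hV).differentiableAt
      (hV.mem_nhds hzV)).differentiableWithinAt
    set ρ := min R (min (x₀ - a) (b - x₀)) with hρ
    have hρ0 : 0 < ρ := lt_min hR (lt_min (sub_pos.2 hx₀.1) (sub_pos.2 hx₀.2))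
    have hz1 : 0 < ‖z‖ + 1 := by positivity
    filter_upwards [hU (Ioo_mem_nhdsGT (div_pos hρ0 hz1))] with ε hε
    have hm : MapsTo (fun w : ℂ => (x₀ : ℂ) + ε * w) V (openRectangle a b R) := by
      intro w hw
      have hw1 : ‖w‖ < ‖z‖ + 1 := mem_ball_zero_iff.1 hw.1
      have hw2 : 0 < w.im := hw.2
      have hsmall : ε * ‖w‖ < ρ := by
        have := (lt_div_iff₀ hz1).1 hε.2
        nlinarith [hε.1]
      have hre : |ε * w.re| < ρ := by
        rw [abs_mul, abs_of_pos hε.1]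
        exact (mul_le_mul_of_nonneg_left (Complex.abs_re_le_norm w) hε.1.le).trans_lt hsmall
      have him : ε * w.im < ρ :=
        (mul_le_mul_of_nonneg_left ((le_abs_self _).trans (Complex.abs_im_le_norm w))
          hε.1.le).trans_lt hsmall
      have hρ1 : ρ ≤ R := min_le_left _ _
      have hρ2 : ρ ≤ x₀ - a := (min_le_right _ _).trans (min_le_left _ _)
      have hρ3 : ρ ≤ b - x₀ := (min_le_right _ _).trans (min_le_right _ _)
      have := abs_lt.1 hre
      have hpos := mul_pos hε.1 hw2
      refine ⟨?_, ?_⟩ <;> simp only [Complex.add_re, Complex.add_im, Complex.ofReal_re,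
        Complex.ofReal_im, Complex.re_ofReal_mul, Complex.im_ofReal_mul, mem_Ioo] <;>
        constructor <;> linarith
    exact ((hd.comp (by fun_prop) hm).sub_const _).div_const _
  rw [← hHlip.apply_neg_one_of_eq_on_pos h0 hHd hpos]
  exact hH (-1)

/-! ### The boundary value as a distributional derivative. -/

theorem LipschitzWith.comp_line {G : ℂ → ℂ} {K : ℝ≥0} (hG : LipschitzWith K G) (c : ℂ) :
    LipschitzWith K fun x : ℝ => G (x + c) :=
  LipschitzWith.of_dist_le_mul fun x y => by
    simpa [dist_eq_norm, ← Complex.ofReal_sub] using hG.dist_le_mul (x + c) (y + c)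

/-- If `G` is a Lipschitz primitive of `F` in the rectangle, then the boundary value of `F` is the
distributional derivative of the restriction of `G` to the real axis. -/
theorem tendsto_integral_boundary {a b R : ℝ} (hR : 0 < R) {F G : ℂ → ℂ} {K : ℝ≥0}
    (hG : LipschitzWith K G) (hd : ∀ z ∈ openRectangle a b R, HasDerivAt G (F z) z)
    (φ : 𝓓(openInterval a b, ℝ)) :
    Tendsto (fun y : ℝ => ∫ x : ℝ, φ x • F (x + y * Complex.I)) (𝓝[>] 0)
      (𝓝 (∫ x, φ x • deriv (fun t : ℝ => G t) x)) := by
  have hφ : ContDiff ℝ ∞ φ := φ.contDiff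
  have hφ' : Continuous (deriv φ) := hφ.continuous_deriv (by simp)
  have hg : LipschitzWith K fun t : ℝ => G t := by simpa using hG.comp_line 0
  have heq : ∀ᶠ y : ℝ in 𝓝[>] 0, -∫ x, deriv φ x • G (x + y * Complex.I) =
      ∫ x : ℝ, φ x • F (x + y * Complex.I) := by
    filter_upwards [Ioo_mem_nhdsGT hR] with y hy
    rw [← (hG.comp_line (y * Complex.I)).integral_smul_deriv_eq hφ φ.hasCompactSupport]
    congr 1
    ext1 x
    by_cases hx : x ∈ tsupport φ
    · have hx' : x ∈ Ioo a b := φ.tsupport_subset hx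
      have := (hd (x + y * Complex.I) ⟨by simpa using hx', by simpa using hy⟩).scomp_of_eq x
        (Complex.ofRealCLM.hasDerivAt.add_const (y * Complex.I)) rfl
      rw [HasDerivAt.deriv (by simpa [Function.comp_def] using this)]
    · simp [image_eq_zero_of_notMem_tsupport hx]
  refine Tendsto.congr' heq ?_
  rw [hg.integral_smul_deriv_eq hφ φ.hasCompactSupport]
  refine (Tendsto.neg ?_).mono_left nhdsWithin_le_nhds
  have hGc := hG.continuous
  have hcont : Continuous fun y : ℝ => ∫ x, deriv φ x • G (x + y * Complex.I) := by
    rw [← continuousOn_univ]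
    refine continuousOn_integral_of_compact_support φ.hasCompactSupport.isCompact ?_ ?_
    · fun_prop
    · intro y x _ hx
      rw [image_eq_zero_of_notMem_tsupport fun h => hx (tsupport_deriv_subset h), zero_smul]
  simpa using hcont.tendsto 0

/-! ### Dilations at a point and derivatives of the primitive. -/

theorem eventually_coe_dilateTest {V Ω : Opens ℝ} {x₀ : ℝ} (hx₀ : x₀ ∈ Ω) (φ : 𝓓(V, ℝ)) :
    ∀ᶠ ε : ℝ in 𝓝[>] 0,
      (dilateTest Ω x₀ ε φ : ℝ → ℝ) = fun t => ε⁻¹ * φ (ε⁻¹ * (t - x₀)) := by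
  obtain ⟨δ, hδ, hball⟩ := Metric.isOpen_iff.1 Ω.isOpen x₀ hx₀
  obtain ⟨r, hr⟩ := φ.hasCompactSupport.isCompact.isBounded.subset_closedBall (0 : ℝ)
  have hr1 : 0 < |r| + 1 := by positivity
  filter_upwards [Ioo_mem_nhdsGT (div_pos hδ hr1)] with ε hε
  have hsub : tsupport (fun t : ℝ => ε⁻¹ * φ (ε⁻¹ * (t - x₀))) ⊆ Ω := by
    intro t ht
    have h1 : ε⁻¹ * (t - x₀) ∈ tsupport φ :=
      tsupport_comp_subset_preimage φ (f := fun t : ℝ => ε⁻¹ * (t - x₀)) (by fun_prop)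
        (tsupport_mul_subset_right ht)
    have h2 : |ε⁻¹ * (t - x₀)| ≤ r := by simpa using hr h1
    rw [abs_mul, abs_of_pos (inv_pos.2 hε.1), inv_mul_le_iff₀ hε.1] at h2
    refine hball (Metric.mem_ball.2 ?_)
    have h3 := (lt_div_iff₀ hr1).1 hε.2
    rw [Real.dist_eq]
    nlinarith [le_abs_self r, hε.1]
  rw [dilateTest, dif_pos ⟨hε.1.ne', hsub⟩]
  rfl

theorem eventually_apply_dilateTest {V Ω : Opens ℝ} {T : 𝓓'(Ω, ℂ)} {f : ℝ → ℂ}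
    (hT : ∀ φ : 𝓓(Ω, ℝ), T φ = ∫ x, φ x • f x) {x₀ : ℝ} (hx₀ : x₀ ∈ Ω) (φ : 𝓓(V, ℝ)) :
    ∀ᶠ ε : ℝ in 𝓝[>] 0, T (dilateTest Ω x₀ ε φ) = ∫ s, φ s • f (x₀ + ε * s) := by
  filter_upwards [eventually_coe_dilateTest hx₀ φ, self_mem_nhdsWithin] with ε hε hpos
  have hpos : 0 < ε := hpos
  have h1 := Measure.integral_comp_mul_left (fun u => φ (ε⁻¹ * u) • f (x₀ + u)) ε
  simp only [inv_mul_cancel_left₀ hpos.ne'] at h1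
  have h2 := integral_add_left_eq_self (μ := volume) (fun t => φ (ε⁻¹ * (t - x₀)) • f t) x₀
  simp only [add_sub_cancel_left] at h2
  rw [hT, hε, h1, h2, abs_of_pos (inv_pos.2 hpos), ← integral_smul]
  simp only [mul_smul]

theorem LipschitzWith.real_blowup {g : ℝ → ℂ} {K : ℝ≥0} (hg : LipschitzWith K g) (x₀ : ℝ) {ε : ℝ}
    (hε : 0 < ε) : LipschitzWith K fun s => ε⁻¹ • (g (x₀ + ε * s) - g x₀) := by
  refine LipschitzWith.of_dist_le_mul fun s t => ?_
  have := hg.dist_le_mul (x₀ + ε * s) (x₀ + ε * t)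
  rw [dist_eq_norm, dist_eq_norm, add_sub_add_left_eq_sub, ← mul_sub, norm_mul,
    Real.norm_of_nonneg hε.le] at this
  rw [dist_eq_norm, dist_eq_norm, ← smul_sub, sub_sub_sub_cancel_right, norm_smul, norm_inv,
    Real.norm_of_nonneg hε.le, inv_mul_le_iff₀ hε]
  linarith

theorem deriv_real_blowup (g : ℝ → ℂ) (x₀ : ℝ) {ε : ℝ} (hε : 0 < ε) (s : ℝ) :
    deriv (fun s => ε⁻¹ • (g (x₀ + ε * s) - g x₀)) s = deriv g (x₀ + ε * s) := by
  have h := deriv_comp_mul_left ε (fun u => g (x₀ + u)) s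
  rw [deriv_comp_const_add] at h
  rw [deriv_fun_const_smul_field, deriv_sub_const, h, smul_smul, inv_mul_cancel₀ hε.ne', one_smul]

/-- If the primitive of a distribution is differentiable at a point, then its dilations at that
point converge to the constant given by the derivative. -/
theorem hasDilationLimit_of_hasDerivAt {V Ω : Opens ℝ} {T : 𝓓'(Ω, ℂ)} {g : ℝ → ℂ} {K : ℝ≥0}
    (hg : LipschitzWith K g) (hT : ∀ φ : 𝓓(Ω, ℝ), T φ = ∫ x, φ x • deriv g x) {x₀ : ℝ}
    (hx₀ : x₀ ∈ Ω) {γ : ℂ} (hγ : HasDerivAt g γ x₀) : HasDilationLimit V T x₀ γ := by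
  intro φ
  have hφ : ContDiff ℝ ∞ φ := φ.contDiff
  have hφ' : Continuous (deriv φ) := hφ.continuous_deriv (by simp)
  have hlin : LipschitzWith ‖γ‖₊ fun s : ℝ => s • γ :=
    LipschitzWith.of_dist_le_mul fun s t => by
      rw [dist_eq_norm, dist_eq_norm, ← sub_smul, norm_smul, mul_comm, coe_nnnorm]
  have hlim : γ * ((∫ x, φ x : ℝ) : ℂ) = -∫ s, deriv φ s • s • γ := by
    rw [← hlin.integral_smul_deriv_eq hφ φ.hasCompactSupport, mul_comm, ← Complex.real_smul,
      ← integral_smul_const]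
    congr 1
    ext1 s
    rw [((hasDerivAt_id' s).smul_const γ).deriv, one_smul]
  rw [hlim]
  have heq : ∀ᶠ ε : ℝ in 𝓝[>] 0, -∫ s, deriv φ s • ε⁻¹ • (g (x₀ + ε * s) - g x₀) =
      T (dilateTest Ω x₀ ε φ) := by
    filter_upwards [eventually_apply_dilateTest hT hx₀ φ, self_mem_nhdsWithin] with ε hε hpos
    rw [hε, ← (hg.real_blowup x₀ hpos).integral_smul_deriv_eq hφ φ.hasCompactSupport]
    simp only [deriv_real_blowup g x₀ hpos]
  refine Tendsto.congr' heq (Tendsto.neg ?_)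
  have hgc := hg.continuous
  -- The blow-ups are `K`-Lipschitz and vanish at `0`, hence are bounded by `K * ‖s‖`.
  refine tendsto_integral_filter_of_dominated_convergence (fun s => ‖deriv φ s‖ * (K * ‖s‖))
    (Eventually.of_forall fun ε => ?_) ?_ ?_ (Eventually.of_forall fun s => ?_)
  · exact Continuous.aestronglyMeasurable (by fun_prop)
  · filter_upwards [self_mem_nhdsWithin] with ε hε
    refine Eventually.of_forall fun s => ?_
    rw [norm_smul]
    gcongr
    simpa [dist_eq_norm] using (hg.real_blowup x₀ hε).dist_le_mul s 0
  · refine Continuous.integrable_of_hasCompactSupport (by fun_prop) ?_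
    exact φ.hasCompactSupport.deriv.norm.mul_right
  · refine Tendsto.const_smul ?_ _
    have hc : HasDerivAt (fun ε : ℝ => g (x₀ + ε * s)) (s • γ) 0 :=
      HasDerivAt.scomp_of_eq 0 hγ (by simpa using ((hasDerivAt_id' (0 : ℝ)).mul_const s).const_add x₀)
        (by simp)
    simpa using hc.tendsto_slope_zero_right

theorem exists_testFunction_near_indicator {δ : ℝ} (hδ : 0 < δ) (hδ' : δ < 1 / 4) :
    ∃ φ : 𝓓(rightHalfLine, ℝ),
      ∫ s, |(Ioc (0 : ℝ) 1).indicator 1 s - φ s| ≤ 2 * δ := by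
  -- Equal to `1` on `[δ, 1 - δ]` and supported in `[δ/2, 1 - δ/2]`, hence away from `0`.
  let β : ContDiffBump (1 / 2 : ℝ) :=
    ⟨1 / 2 - δ, 1 / 2 - δ / 2, by linarith, by linarith⟩
  have hball : Metric.closedBall (1 / 2 : ℝ) (1 / 2 - δ / 2) = Icc (δ / 2) (1 - δ / 2) := by
    rw [Real.closedBall_eq_Icc]; congr 1 <;> ring
  have hts : tsupport (β : ℝ → ℝ) = Icc (δ / 2) (1 - δ / 2) := β.tsupport_eq.trans hball
  let φ : 𝓓(rightHalfLine, ℝ) :=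
    { toFun := β
      contDiff' := β.contDiff
      hasCompactSupport' := β.hasCompactSupport
      tsupport_subset' := by
        rw [hts]
        exact fun s hs => show (0 : ℝ) < s from (half_pos hδ).trans_le hs.1 }
  refine ⟨φ, ?_⟩
  have hφ : ∀ s, φ s = β s := fun _ => rfl
  have hle : ∀ s, |(Ioc (0 : ℝ) 1).indicator 1 s - φ s| ≤
      (Icc 0 δ ∪ Icc (1 - δ) 1).indicator (1 : ℝ → ℝ) s := by
    intro s
    rw [hφ]
    by_cases h1 : s ∈ Icc 0 δ ∪ Icc (1 - δ) 1
    · rw [indicator_of_mem h1, Pi.one_apply, abs_le]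
      have := β.nonneg (x := s)
      have := β.le_one (x := s)
      by_cases h2 : s ∈ Ioc (0 : ℝ) 1
      · rw [indicator_of_mem h2, Pi.one_apply]; constructor <;> linarith
      · rw [indicator_of_notMem h2]; constructor <;> linarith
    · rw [indicator_of_notMem h1]
      simp only [mem_union, mem_Icc, not_or, not_and, not_le] at h1
      refine (abs_eq_zero.2 ?_).le
      by_cases h2 : s ∈ Ioc (0 : ℝ) 1
      · have h3 : β s = 1 := by
          refine β.one_of_mem_closedBall ?_
          have : δ < s := h1.1 h2.1.le
          have : s < 1 - δ := by
            by_contra h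
            exact (h1.2 (not_lt.1 h)).not_ge h2.2
          rw [Real.closedBall_eq_Icc]
          constructor <;> simp only [β] <;> linarith
        rw [indicator_of_mem h2, Pi.one_apply, h3, sub_self]
      · rw [indicator_of_notMem h2, image_eq_zero_of_notMem_tsupport (f := β) (x := s), sub_self]
        rw [hts]
        exact fun h => h2 ⟨by linarith [h.1], by linarith [h.2]⟩
  have hmeas : MeasurableSet (Icc 0 δ ∪ Icc (1 - δ) 1) := measurableSet_Icc.union measurableSet_Icc
  have hfin : volume (Icc 0 δ ∪ Icc (1 - δ) 1) ≠ ⊤ :=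
    ((measure_union_le _ _).trans_lt (by simp [ENNReal.add_lt_top])).ne
  calc ∫ s, |(Ioc (0 : ℝ) 1).indicator 1 s - φ s|
      ≤ ∫ s, (Icc 0 δ ∪ Icc (1 - δ) 1).indicator (1 : ℝ → ℝ) s :=
        integral_mono_of_nonneg (Eventually.of_forall fun _ => abs_nonneg _)
          ((integrable_indicator_iff hmeas).2 (integrableOn_const hfin)) (Eventually.of_forall hle)
    _ = volume.real (Icc 0 δ ∪ Icc (1 - δ) 1) := integral_indicator_one hmeas
    _ ≤ volume.real (Icc 0 δ) + volume.real (Icc (1 - δ) 1) := measureReal_union_le _ _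
    _ = 2 * δ := by
        rw [Real.volume_real_Icc_of_le hδ.le, Real.volume_real_Icc_of_le (by linarith)]; ring

/-- If a distribution with Lipschitz primitive `g` has a right limit, then `g` has a right
derivative. -/
theorem HasRightLimit.tendsto_right_slope {Ω : Opens ℝ} {T : 𝓓'(Ω, ℂ)} {g : ℝ → ℂ} {K : ℝ≥0}
    (hg : LipschitzWith K g) (hT : ∀ φ : 𝓓(Ω, ℝ), T φ = ∫ x, φ x • deriv g x) {x₀ : ℝ}
    (hx₀ : x₀ ∈ Ω) {γ : ℂ} (hγ : HasRightLimit T x₀ γ) :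
    Tendsto (fun ε : ℝ => ε⁻¹ • (g (x₀ + ε) - g x₀)) (𝓝[>] 0) (𝓝 γ) := by
  rw [Metric.tendsto_nhds]
  intro η hη
  -- Replacing the indicator by `φ` costs `2δK` in the pairing and `2δ‖γ‖` in the limit; the other
  -- `η / 2` is for the lateral limit.
  obtain ⟨δ, hδ, hδη⟩ : ∃ δ : ℝ, (0 < δ ∧ δ < 1 / 4) ∧ 2 * δ * (K + ‖γ‖) < η / 2 := by
    have hM : 0 < K + ‖γ‖ + 1 := by positivity
    have hp : 0 < min (1 / 8) (η / (8 * (K + ‖γ‖ + 1))) := by positivity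
    refine ⟨min (1 / 8) (η / (8 * (K + ‖γ‖ + 1))),
      ⟨hp, (min_le_left _ _).trans_lt (by norm_num)⟩, ?_⟩
    have h1 := (le_div_iff₀ (by positivity)).1 (min_le_right (1 / 8) (η / (8 * (K + ‖γ‖ + 1))))
    nlinarith
  obtain ⟨φ, hφ⟩ := exists_testFunction_near_indicator hδ.1 hδ.2
  set χ : ℝ → ℝ := (Ioc (0 : ℝ) 1).indicator 1 with hχ
  have hχi : Integrable χ :=
    (integrable_indicator_iff measurableSet_Ioc).2 (integrableOn_const (by simp))
  have hφi : Integrable φ := φ.continuous.integrable_of_hasCompactSupport φ.hasCompactSupport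
  have hχ1 : ∫ s, χ s = 1 := by
    rw [hχ, integral_indicator_one measurableSet_Ioc, Real.volume_real_Ioc_of_le zero_le_one,
      sub_zero]
  have hγφ : ‖γ * ((∫ s, φ s : ℝ) : ℂ) - γ‖ ≤ 2 * δ * ‖γ‖ := by
    have h1 : ‖(((∫ s, φ s) - 1 : ℝ) : ℂ)‖ ≤ 2 * δ := by
      rw [Complex.norm_real, ← hχ1, ← integral_sub hφi hχi]
      refine (norm_integral_le_integral_norm _).trans ?_
      simpa only [Real.norm_eq_abs, abs_sub_comm] using hφ
    calc ‖γ * ((∫ s, φ s : ℝ) : ℂ) - γ‖ = ‖γ‖ * ‖(((∫ s, φ s) - 1 : ℝ) : ℂ)‖ := by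
          rw [← norm_mul]; congr 1; push_cast; ring
      _ ≤ ‖γ‖ * (2 * δ) := by gcongr
      _ = 2 * δ * ‖γ‖ := mul_comm _ _
  filter_upwards [Metric.tendsto_nhds.1 (hγ φ) (η / 2) (half_pos hη),
    eventually_apply_dilateTest hT hx₀ φ, self_mem_nhdsWithin] with ε h1 h2 hε
  have hL := hg.real_blowup x₀ hε
  have hbound : ∀ s, ‖deriv g (x₀ + ε * s)‖ ≤ K := fun s => norm_deriv_le_of_lipschitz hg
  have hmeas : AEStronglyMeasurable (fun s => deriv g (x₀ + ε * s)) volume :=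
    ((measurable_deriv g).comp (by fun_prop)).aestronglyMeasurable
  have e1 : ε⁻¹ • (g (x₀ + ε) - g x₀) = ∫ s, χ s • deriv g (x₀ + ε * s) := by
    have := hL.intervalIntegral_deriv_eq_sub 0 1
    simp only [deriv_real_blowup g x₀ hε, mul_one, mul_zero, add_zero, sub_self, smul_zero,
      sub_zero] at this
    rw [← this, intervalIntegral.integral_of_le zero_le_one, ← integral_indicator measurableSet_Ioc]
    congr 1
    ext1 s
    by_cases hs : s ∈ Ioc (0 : ℝ) 1
    · rw [hχ, indicator_of_mem hs, indicator_of_mem hs, Pi.one_apply, one_smul]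
    · rw [hχ, indicator_of_notMem hs, indicator_of_notMem hs, zero_smul]
  have e2 : ‖(∫ s, χ s • deriv g (x₀ + ε * s)) - ∫ s, φ s • deriv g (x₀ + ε * s)‖ ≤ 2 * δ * K := by
    have i1 : Integrable fun s => χ s • deriv g (x₀ + ε * s) :=
      hχi.smul_bdd K hmeas (Eventually.of_forall hbound)
    have i2 : Integrable fun s => φ s • deriv g (x₀ + ε * s) :=
      hφi.smul_bdd K hmeas (Eventually.of_forall hbound)
    rw [← integral_sub i1 i2]
    simp only [← sub_smul]
    calc _ ≤ ∫ s, |χ s - φ s| * K := by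
          refine norm_integral_le_of_norm_le ((hχi.sub hφi).abs.mul_const _)
            (Eventually.of_forall fun s => ?_)
          rw [norm_smul, Real.norm_eq_abs]
          exact mul_le_mul_of_nonneg_left (hbound s) (abs_nonneg _)
      _ = (∫ s, |χ s - φ s|) * K := integral_mul_const _ _
      _ ≤ 2 * δ * K := by gcongr
  rw [h2] at h1
  rw [dist_eq_norm] at h1 ⊢
  rw [e1]
  have t := norm_add₃_le (a := (∫ s, χ s • deriv g (x₀ + ε * s)) - ∫ s, φ s • deriv g (x₀ + ε * s))
    (b := (∫ s, φ s • deriv g (x₀ + ε * s)) - γ * ((∫ s, φ s : ℝ) : ℂ))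
    (c := γ * ((∫ s, φ s : ℝ) : ℂ) - γ)
  rw [sub_add_sub_cancel, sub_add_sub_cancel] at t
  nlinarith

/-! ### First-order point values, uniqueness of the density, and the theorem. -/

/-- The distribution on `Ω` defined by a locally integrable function. -/
noncomputable def distributionOfFun (Ω : Opens ℝ) (h : ℝ → ℂ) : 𝓓'(Ω, ℂ) :=
  TestFunction.integralAgainstBilinCLM (ContinuousLinearMap.lsmul ℝ ℝ) volume h

theorem distributionOfFun_apply {Ω : Opens ℝ} {h : ℝ → ℂ} (hh : LocallyIntegrableOn h Ω)
    (φ : 𝓓(Ω, ℝ)) : distributionOfFun Ω h φ = ∫ x, φ x • h x :=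
  TestFunction.integralAgainstBilinCLM_eq_integral hh

/-- The witness is `dslope g x₀`: multiplied by `x - x₀` it gives `g - g x₀`, whose derivative is
`T`, and differentiability of `g` at `x₀` makes it continuous there with value `γ`. -/
theorem hasPointValueOfOrder_one_of_hasDerivAt {Ω : Opens ℝ} {T : 𝓓'(Ω, ℂ)} {g : ℝ → ℂ}
    {K : ℝ≥0} (hg : LipschitzWith K g) (hT : ∀ φ : 𝓓(Ω, ℝ), T φ = ∫ x, φ x • deriv g x) {x₀ : ℝ}
    (hx₀ : x₀ ∈ Ω) {γ : ℂ} (hγ : HasDerivAt g γ x₀) : HasPointValueOfOrder 1 T x₀ γ := by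
  have hcont : Continuous (dslope g x₀) := by
    rw [← continuousOn_univ, continuousOn_dslope univ_mem]
    exact ⟨hg.continuous.continuousOn, hγ.differentiableAt⟩
  have hloc : LocallyIntegrable (dslope g x₀) := hcont.locallyIntegrable
  refine ⟨fun k => if k = 0 then T else distributionOfFun Ω (dslope g x₀), rfl, ?_,
    Ω, dslope g x₀, Ω.isOpen, hx₀, Subset.rfl, hcont.continuousOn, by rw [dslope_same, hγ.deriv],
    hloc.locallyIntegrableOn _, ?_⟩
  · intro k hk φ
    obtain rfl : k = 0 := by omega
    have hφ : ContDiff ℝ ∞ φ := φ.contDiff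
    have hg' : LipschitzWith K fun x => g x - g x₀ :=
      LipschitzWith.of_dist_le_mul fun x y => by simpa using hg.dist_le_mul x y
    simp only [zero_add, one_ne_zero, if_true, if_false]
    rw [distributionOfFun_apply (hloc.locallyIntegrableOn _), hT]
    have := hg'.integral_smul_deriv_eq hφ φ.hasCompactSupport
    simp only [deriv_sub_const] at this
    rw [this, ← integral_neg]
    congr 1
    ext1 x
    change _ = (-(x - x₀) * deriv φ x) • dslope g x₀ x
    rw [← sub_smul_dslope g x₀ x, smul_smul, ← neg_smul]
    congr 1
    ring
  · intro φ _
    simpa using distributionOfFun_apply (hloc.locallyIntegrableOn _) φ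

theorem LipschitzWith.memLp_top_deriv {g : ℝ → ℂ} {K : ℝ≥0} (hg : LipschitzWith K g)
    (μ : Measure ℝ) : MemLp (deriv g) ⊤ μ :=
  memLp_top_of_bound (measurable_deriv g).aestronglyMeasurable K
    (Eventually.of_forall fun _ => norm_deriv_le_of_lipschitz hg)

theorem IsGivenByOn.ae_eq {a b : ℝ} {T : 𝓓'(openInterval a b, ℂ)} {f h : ℝ → ℂ}
    (hf : IsGivenByOn T f (Ioo a b)) (hh : IsGivenByOn T h (Ioo a b)) :
    ∀ᵐ x, x ∈ Ioo a b → f x = h x := by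
  have := isOpen_Ioo.ae_eq_zero_of_integral_contDiff_smul_eq_zero (μ := volume)
    (f := fun x => f x - h x) (hf.1.sub hh.1) ?_
  · filter_upwards [this] with x hx hxI using sub_eq_zero.1 (hx hxI)
  · intro u hu hc hs
    let φ : 𝓓(openInterval a b, ℝ) := ⟨u, hu, hc, hs⟩
    have h1 : Integrable fun x => u x • f x := TestFunction.integrable_bilin
      (ContinuousLinearMap.lsmul ℝ ℝ) (μ := volume) (φ := f) hf.1 φ
    have h2 : Integrable fun x => u x • h x := TestFunction.integrable_bilin
      (ContinuousLinearMap.lsmul ℝ ℝ) (μ := volume) (φ := h) hh.1 φ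
    have e1 : T φ = ∫ x, u x • f x := hf.2 φ hs
    have e2 : T φ = ∫ x, u x • h x := hh.2 φ hs
    simp only [smul_sub]
    rw [integral_sub h1 h2, ← e1, ← e2, sub_self]

theorem hasDerivAt_of_tendsto_right_left {g : ℝ → ℂ} {x₀ : ℝ} {γ : ℂ}
    (hr : Tendsto (fun ε : ℝ => ε⁻¹ • (g (x₀ + ε) - g x₀)) (𝓝[>] 0) (𝓝 γ))
    (hl : Tendsto (fun ε : ℝ => ε⁻¹ • (g (x₀ - ε) - g x₀)) (𝓝[>] 0) (𝓝 (-γ))) :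
    HasDerivAt g γ x₀ := by
  rw [hasDerivAt_iff_tendsto_slope_zero, ← Iio_union_Ioi, nhdsWithin_union, tendsto_sup]
  refine ⟨?_, hr⟩
  have hm : Tendsto (fun t : ℝ => -t) (𝓝[<] 0) (𝓝[>] 0) := by
    simpa using tendsto_neg_nhdsLT (a := (0 : ℝ))
  simpa [Function.comp_def] using (hl.comp hm).neg

theorem theorem3p1 (a b R : ℝ) (hab : a < b) (hR : 0 < R) (F : ℂ → ℂ)
    (hF : AnalyticOnNhd ℂ F {z : ℂ | z.re ∈ Ioo a b ∧ z.im ∈ Ioo 0 R})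
    (hbdd : ∃ M : ℝ, ∀ z : ℂ, z.re ∈ Ioo a b → z.im ∈ Ioo 0 R → ‖F z‖ ≤ M) :
    (∃ T : 𝓓'(openInterval a b, ℂ), IsBoundaryValue F T) ∧
    ∀ T : 𝓓'(openInterval a b, ℂ), IsBoundaryValue F T →
      (∃ f : ℝ → ℂ, MemLp f ⊤ (volume.restrict (Ioo a b)) ∧ IsGivenByOn T f (Ioo a b)) ∧
      ∀ x₀ ∈ Ioo a b, ∀ γ : ℂ, HasRightLimit T x₀ γ →
        HasPointValue T x₀ γ ∧
        HasPointValueOfOrder 1 T x₀ γ ∧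
        HasDilationLimit ⊤ T x₀ γ ∧
        ∀ f : ℝ → ℂ, MemLp f ⊤ (volume.restrict (Ioo a b)) → IsGivenByOn T f (Ioo a b) →
          Tendsto (fun x : ℝ => (x - x₀)⁻¹ • ∫ t in x₀..x, f t) (𝓝[≠] x₀) (𝓝 γ) := by
  obtain ⟨M, hM⟩ := hbdd
  obtain ⟨G, K, hG, hGd⟩ := exists_lipschitzWith_primitive (a := a) (b := b) (R := R)
    hF.differentiableOn ⟨M, fun z hz => hM z hz.1 hz.2⟩
  set g : ℝ → ℂ := fun t => G t with hg_def
  have hg : LipschitzWith K g := by simpa using hG.comp_line 0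
  have hloc : LocallyIntegrable (deriv g) := hg.locallyIntegrable_deriv
  have hlim := tendsto_integral_boundary hR hG hGd
  refine ⟨⟨distributionOfFun _ (deriv g), fun φ => ?_⟩, fun T hTF => ?_⟩
  · rw [distributionOfFun_apply (hloc.locallyIntegrableOn _)]
    exact hlim φ
  have hT : ∀ φ : 𝓓(openInterval a b, ℝ), T φ = ∫ x, φ x • deriv g x := fun φ =>
    tendsto_nhds_unique (hTF φ) (hlim φ)
  have hgiven : IsGivenByOn T (deriv g) (Ioo a b) := ⟨hloc.locallyIntegrableOn _, fun φ _ => hT φ⟩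
  refine ⟨⟨deriv g, hg.memLp_top_deriv _, hgiven⟩, fun x₀ hx₀ γ hγ => ?_⟩
  have hr := hγ.tendsto_right_slope hg hT hx₀
  have hl := hG.tendsto_left_of_tendsto_right hR hx₀
    (fun z hz => (hGd z hz).differentiableAt.differentiableWithinAt) (γ := γ)
    (by simpa [hg_def, div_eq_inv_mul] using hr)
  have hderiv : HasDerivAt g γ x₀ :=
    hasDerivAt_of_tendsto_right_left hr
      (by simpa [hg_def, div_eq_inv_mul, ← sub_eq_add_neg] using hl)
  have hone := hasPointValueOfOrder_one_of_hasDerivAt hg hT hx₀ hderiv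
  refine ⟨⟨1, hone⟩, hone, hasDilationLimit_of_hasDerivAt hg hT hx₀ hderiv, fun f _ hf => ?_⟩
  -- Any density `f` agrees almost everywhere on `(a, b)` with `deriv g`, so its mean from `x₀` to a
  -- nearby `x` is the slope of `g`.
  refine (hasDerivAt_iff_tendsto_slope.1 hderiv).congr' ?_
  filter_upwards [mem_nhdsWithin_of_mem_nhds (Ioo_mem_nhds hx₀.1 hx₀.2)] with x hx
  rw [slope_def_module, ← hg.intervalIntegral_deriv_eq_sub]
  congr 1
  refine intervalIntegral.integral_congr_ae ?_
  filter_upwards [hgiven.ae_eq hf] with t ht htx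
  exact ht (ordConnected_Ioo.uIcc_subset hx₀ hx (uIoc_subset_uIcc htx))
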